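/- Let $d\ge 1$ and $N\ge 2$ be integers, let $|\cdot|$ be the max-norm, and let $(\Omega,\mathfrak B,\mathbb P)$ be a probability space. (I) Let $U:\mathbb R\to\mathbb R$ be non-negative and square integrable, and of finite range: there is $r_0>0$ such that $U(|x-y|)=0$ for all $x,y\in\mathbb R^d$ with $|x-y|>r_0$. For $1\le n\le N$ and $\mathbf x=(x_1,\dots,x_n)\in(\mathbb R^d)^n$ put $\mathbf U^{(n)}(\mathbf x)=\sum_{1\le i<j\le n}U(|x_i-x_j|)$ (so $\mathbf U^{(1)}=0$). (P) Let $\{V(x,\cdot)\}_{x\in\mathbb R^d}$ be an i.i.d. family of real random variables whose sample paths $x\mapsto V(x,\omega)$ are almost surely non-negative and in $L^2(\mathbb R^d)$ (joint measurability in $(x,\omega)$ is not required). Put $\mathbf V^{(n)}(\mathbf x,\omega)=V(x_1,\omega)+\cdots+V(x_n,\omega)$. For $1\le n\le N$ let $\mathbf H_0^{(n)}(\omega)=-\mathbf\Delta+\mathbf V^{(n)}(\cdot,\omega)$ and $\mathbf H^{(n)}(\omega)=-\mathbf\Delta+\mathbf U^{(n)}+\mathbf V^{(n)}(\cdot,\omega)$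 be the self-adjoint operators on $L^2((\mathbb R^d)^n)$ associated with the closed quadratic forms $u\mapsto\int|\nabla u|^2+\int W|u|^2$ on $\{u\in H^1((\mathbb R^d)^n):\sqrt W\,u\in L^2\}$, where $W=\mathbf V^{(n)}(\cdot,\omega)$ and $W=\mathbf U^{(n)}+\mathbf V^{(n)}(\cdot,\omega)$ respectively. Let $\sigma(\cdot)$ denote the spectrum and $E_0^{(n)}(\omega)=\inf\sigma(\mathbf H^{(n)}(\omega))$. (R) Assume that, almost surely, the operator $\mathbf U^{(N)}(\mathbf H_0^{(N)}(\omega)-i)^{-1}$ is bounded. Then, with $\mathbb P$-probability $1$, $$0\in\sigma(\mathbf H^{(N)}(\omega))\subset[0,+\infty).$$ Consequently, for every $n=1,\dots,N$, $E_0^{(n)}(\omega)=0$ almost surely. -/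

import Mathlib

open MeasureTheory ProbabilityTheory
open scoped InnerProductSpace

noncomputable section

namespace Anderson

/-! ### Spectrum of an unbounded operator -/

section Spectrum

variable {E : Type*} [NormedAddCommGroup E] [NormedSpace ℂ E]

/-- `R` is the (everywhere defined, bounded) inverse of `T - z : D(T) → E`. -/
def IsResolventAt (T : E →ₗ.[ℂ] E) (z : ℂ) (R : E →L[ℂ] E) : Prop :=
  (∀ f : E, ∃ h : R f ∈ T.domain, T ⟨R f, h⟩ - z • R f = f) ∧
    ∀ u : T.domain, R (T u - z • (u : E)) = u

/-- The resolvent set of an unbounded operator `T`. -/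
def resolventSet (T : E →ₗ.[ℂ] E) : Set ℂ :=
  {z | ∃ R : E →L[ℂ] E, IsResolventAt T z R}

/-- The spectrum `σ(T) ⊆ ℂ` of an unbounded operator `T`. -/
def spec (T : E →ₗ.[ℂ] E) : Set ℂ := (resolventSet T)ᶜ

/-- The bottom of the spectrum, `inf σ(T)`, for an operator with real spectrum. It is computed in
the extended reals, so that it is the true infimum (`⊤` if the spectrum is empty, `⊥` if it is not
bounded below). -/
def specBottom (T : E →ₗ.[ℂ] E) : EReal := ⨅ z ∈ spec T, ((z.re : ℝ) : EReal)

end Spectrum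

/-! ### Schrödinger operators on `(ℝ^d)^n` -/

/-- The configuration space `(ℝ^d)^n` of `n` particles. Its norm is the max-norm and its `volume`
is Lebesgue measure. -/
abbrev Config (n d : ℕ) : Type := Fin n → Fin d → ℝ

/-- The complex Hilbert space `L²((ℝ^d)^n)`. -/
abbrev L2 (n d : ℕ) : Type := Lp ℂ 2 (volume : Measure (Config n d))

variable {n d : ℕ}

/-- The unit vector of `(ℝ^d)^n` in the direction of the `p.2`-th coordinate of particle `p.1`. -/
def unitVec (p : Fin n × Fin d) : Config n d := Pi.single p.1 (Pi.single p.2 1)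

/-- `g` is the weak gradient of `u`; thus `u ∈ H¹((ℝ^d)^n)` iff `∃ g, IsWeakGrad u g`. -/
def IsWeakGrad (u : L2 n d) (g : Fin n × Fin d → L2 n d) : Prop :=
  ∀ (p : Fin n × Fin d) (φ : Config n d → ℝ), ContDiff ℝ (⊤ : ℕ∞) φ → HasCompactSupport φ →
    ∫ x, (fderiv ℝ φ x (unitVec p)) • u x = - ∫ x, φ x • g p x

/-- `w = √W u`, as elements of `L²`. -/
def IsSqrtMul (W : Config n d → ℝ) (u w : L2 n d) : Prop :=
  w =ᵐ[volume] fun x => (Real.sqrt (W x) : ℂ) * u x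

lemma integrable_deriv_smul (u : L2 n d) {φ : Config n d → ℝ} (hφ : ContDiff ℝ (⊤ : ℕ∞) φ)
    (hc : HasCompactSupport φ) (e : Config n d) :
    Integrable (fun x => (fderiv ℝ φ x e) • u x) := by
  have hcont : Continuous fun x => fderiv ℝ φ x e :=
    (hφ.continuous_fderiv (by simp)).clm_apply continuous_const
  have hcs : HasCompactSupport fun x => fderiv ℝ φ x e :=
    (hc.fderiv (𝕜 := ℝ)).comp_left (g := fun L : Config n d →L[ℝ] ℝ => L e) (by simp)
  have hm : MemLp (fun x => fderiv ℝ φ x e) 2 volume := hcont.memLp_of_hasCompactSupport hcs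
  exact memLp_one_iff_integrable.1 ((Lp.memLp u).smul hm)

lemma integrable_test_smul (u : L2 n d) {φ : Config n d → ℝ} (hφ : ContDiff ℝ (⊤ : ℕ∞) φ)
    (hc : HasCompactSupport φ) : Integrable (fun x => φ x • u x) := by
  have hm : MemLp φ 2 volume := hφ.continuous.memLp_of_hasCompactSupport hc
  exact memLp_one_iff_integrable.1 ((Lp.memLp u).smul hm)

lemma IsWeakGrad.zero : IsWeakGrad (0 : L2 n d) 0 := by
  intro p φ _ _
  simp

lemma IsWeakGrad.add {u v : L2 n d} {g h : Fin n × Fin d → L2 n d} (hu : IsWeakGrad u g)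
    (hv : IsWeakGrad v h) : IsWeakGrad (u + v) (g + h) := by
  intro p φ hφ hc
  have e1 : ∫ x, (fderiv ℝ φ x (unitVec p)) • (u + v) x
      = ∫ x, ((fderiv ℝ φ x (unitVec p)) • u x + (fderiv ℝ φ x (unitVec p)) • v x) := by
    apply integral_congr_ae
    filter_upwards [Lp.coeFn_add u v] with x hx
    rw [hx, Pi.add_apply, smul_add]
  have e2 : ∫ x, φ x • (g + h) p x = ∫ x, (φ x • g p x + φ x • h p x) := by
    apply integral_congr_ae
    filter_upwards [Lp.coeFn_add (g p) (h p)] with x hx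
    rw [Pi.add_apply, hx, Pi.add_apply, smul_add]
  rw [e1, e2, integral_add (integrable_deriv_smul u hφ hc _) (integrable_deriv_smul v hφ hc _),
    integral_add (integrable_test_smul _ hφ hc) (integrable_test_smul _ hφ hc),
    hu p φ hφ hc, hv p φ hφ hc]
  ring

lemma IsWeakGrad.smul {u : L2 n d} {g : Fin n × Fin d → L2 n d} (c : ℂ) (hu : IsWeakGrad u g) :
    IsWeakGrad (c • u) (c • g) := by
  intro p φ hφ hc
  have e1 : ∫ x, (fderiv ℝ φ x (unitVec p)) • (c • u) x
      = ∫ x, c • ((fderiv ℝ φ x (unitVec p)) • u x) := by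
    apply integral_congr_ae
    filter_upwards [Lp.coeFn_smul c u] with x hx
    rw [hx, Pi.smul_apply, smul_comm]
  have e2 : ∫ x, φ x • (c • g) p x = ∫ x, c • (φ x • g p x) := by
    apply integral_congr_ae
    filter_upwards [Lp.coeFn_smul c (g p)] with x hx
    rw [Pi.smul_apply, hx, Pi.smul_apply, smul_comm]
  rw [e1, e2, integral_smul, integral_smul, hu p φ hφ hc, smul_neg]

lemma IsSqrtMul.zero (W : Config n d → ℝ) : IsSqrtMul W 0 0 := by
  unfold IsSqrtMul
  filter_upwards with x
  simp

lemma IsSqrtMul.add {W : Config n d → ℝ} {u v w s : L2 n d} (hu : IsSqrtMul W u w)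
    (hv : IsSqrtMul W v s) : IsSqrtMul W (u + v) (w + s) := by
  unfold IsSqrtMul at *
  filter_upwards [hu, hv, Lp.coeFn_add u v, Lp.coeFn_add w s] with x h1 h2 h3 h4
  rw [h4, h3, Pi.add_apply, Pi.add_apply, h1, h2, mul_add]

lemma IsSqrtMul.smul {W : Config n d → ℝ} {u w : L2 n d} (c : ℂ) (hu : IsSqrtMul W u w) :
    IsSqrtMul W (c • u) (c • w) := by
  unfold IsSqrtMul at *
  filter_upwards [hu, Lp.coeFn_smul c u, Lp.coeFn_smul c w] with x h1 h2 h3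
  rw [h3, h2, Pi.smul_apply, Pi.smul_apply, h1, smul_eq_mul, smul_eq_mul]
  ring

/-- The graph of the self-adjoint realisation of `-Δ + W`, for a potential `W ≥ 0`. It is the
operator associated with the closed quadratic form
`a(v, u) = ∑ p, ⟪∂ₚ v, ∂ₚ u⟫ + ⟪√W v, √W u⟫` with form domain `{u ∈ H¹ | √W u ∈ L²}`:
the pair `(u, f)` belongs to the graph iff `u` is in the form domain and `a(v, u) = ⟪v, f⟫` for
all `v` in the form domain. -/
def schrodingerGraph (W : Config n d → ℝ) : Submodule ℂ (L2 n d × L2 n d) where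
  carrier := {q | ∃ (g : Fin n × Fin d → L2 n d) (w : L2 n d),
    IsWeakGrad q.1 g ∧ IsSqrtMul W q.1 w ∧
      ∀ (v : L2 n d) (h : Fin n × Fin d → L2 n d) (s : L2 n d),
        IsWeakGrad v h → IsSqrtMul W v s →
          ∑ p, ⟪h p, g p⟫_ℂ + ⟪s, w⟫_ℂ = ⟪v, q.2⟫_ℂ}
  add_mem' := by
    rintro q q' ⟨g, w, hg, hw, H⟩ ⟨g', w', hg', hw', H'⟩
    refine ⟨g + g', w + w', hg.add hg', hw.add hw', fun v h s hv hs => ?_⟩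
    simp only [Pi.add_apply, Prod.snd_add, inner_add_right, Finset.sum_add_distrib]
    rw [← H v h s hv hs, ← H' v h s hv hs]
    ring
  zero_mem' := ⟨0, 0, IsWeakGrad.zero, IsSqrtMul.zero W, fun v h s _ _ => by simp⟩
  smul_mem' := by
    rintro c q ⟨g, w, hg, hw, H⟩
    refine ⟨c • g, c • w, hg.smul c, hw.smul c, fun v h s hv hs => ?_⟩
    simp only [Pi.smul_apply, Prod.smul_snd, inner_smul_right]
    rw [← H v h s hv hs, mul_add, Finset.mul_sum]

/-- The Schrödinger operator `-Δ + W` on `L²((ℝ^d)^n)`, for a potential `W ≥ 0`. -/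
def schrodinger (W : Config n d → ℝ) : L2 n d →ₗ.[ℂ] L2 n d :=
  (schrodingerGraph W).toLinearPMap

/-! ### The multi-particle Anderson model -/

/-- The interaction energy `∑_{i < j} U(|x_i - x_j|)`, where `|·|` is the max-norm of `ℝ^d`. -/
def interaction (U : ℝ → ℝ) (x : Config n d) : ℝ :=
  ∑ i : Fin n, ∑ j ∈ Finset.Ioi i, U ‖x i - x j‖

/-- The external potential `V(x_1) + ⋯ + V(x_n)`. -/
def external (V : (Fin d → ℝ) → ℝ) (x : Config n d) : ℝ := ∑ j : Fin n, V (x j)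

/-- The non-interacting `n`-particle Hamiltonian `H₀ = -Δ + V(x_1) + ⋯ + V(x_n)`. -/
def freeHamiltonian (n : ℕ) (V : (Fin d → ℝ) → ℝ) : L2 n d →ₗ.[ℂ] L2 n d :=
  schrodinger (external V)

/-- The `n`-particle Hamiltonian `H = -Δ + ∑_{i < j} U(|x_i - x_j|) + V(x_1) + ⋯ + V(x_n)`. -/
def hamiltonian (n : ℕ) (U : ℝ → ℝ) (V : (Fin d → ℝ) → ℝ) : L2 n d →ₗ.[ℂ] L2 n d :=
  schrodinger fun x => interaction U x + external V x

/-- The operator `M (T - i)⁻¹` is bounded, where `M` is multiplication by the function `m`: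
some bounded operator `B` satisfies `B (T - i) u = m u` for all `u ∈ D(T)`. (The operator `T` will be
self-adjoint, so `T - i` maps `D(T)` onto the whole space.) -/
def MulResolventBounded (m : Config n d → ℝ) (T : L2 n d →ₗ.[ℂ] L2 n d) : Prop :=
  ∃ B : L2 n d →L[ℂ] L2 n d, ∀ u : T.domain,
    B (T u - Complex.I • (u : L2 n d)) =ᵐ[volume] fun x => (m x : ℂ) * (u : L2 n d) x

end Anderson

end

open Anderson

noncomputable section

namespace Anderson

open Filter Topology ContinuousLinearMap
open scoped ComplexOrder

/-! ### Operators given by their resolvent at `-1` -/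

section Abstract

variable {E : Type*} [NormedAddCommGroup E] [InnerProductSpace ℂ E] [CompleteSpace E]

/-! The argument is deterministic: it treats one realisation `V` in L² at a time. Let J be the
inclusion into L² of the form domain with norm ‖u‖² + a(u, u), where a is the form of -Δ + W. By
Riesz, R = J J† is the resolvent of -Δ + W at -1 (`mem_graph_schrodinger_iff`). Since R is a
positive contraction, the spectrum of R⁻¹ - 1 lies in [0, ∞). If 0 were in the resolvent set, 1 - R
would be bounded below; but ‖Jv - RJv‖² ≤ ‖v‖² - ‖Jv‖² = a(v, v), so test functions of small
Rayleigh quotient exclude this (`zero_mem_spec_of_resolvent`). Such functions come from one bump,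
centred where the particles are far apart, dilated by t² (`exists_small_energy`). For large t the
interaction vanishes on its support; relative to its mass, the kinetic energy is O(t⁻⁴) and, as `V`
is in L², the external energy is O(t⁻¹). -/

lemma nonneg_of_inv_add_one_mem_spectrum {R : E →L[ℂ] E} (hpos : R.IsPositive) (hR : ‖R‖ ≤ 1)
    {z : ℂ} (hz : z + 1 ≠ 0) (h : (z + 1)⁻¹ ∈ spectrum ℂ R) : z.im = 0 ∧ 0 ≤ z.re := by
  have h0 : (0 : ℂ) ≤ (z + 1)⁻¹ :=
    spectrum_nonneg_of_nonneg ((nonneg_iff_isPositive R).2 hpos) h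
  have h1 : ‖(z + 1)⁻¹‖ ≤ 1 := (spectrum.norm_le_norm_mul_of_mem h).trans <|
    mul_le_one₀ hR (norm_nonneg _) (norm_id_le (𝕜 := ℂ) (E := E))
  obtain ⟨r, hr0, hr⟩ : ∃ r : ℝ, 0 ≤ r ∧ (r : ℂ) = (z + 1)⁻¹ := by
    obtain ⟨hre, him⟩ := Complex.nonneg_iff.mp h0
    exact ⟨_, hre, Complex.ext rfl him⟩
  have hz' : z = ((r⁻¹ - 1 : ℝ) : ℂ) := by
    push_cast
    rw [hr, inv_inv]
    ring
  have hr1 : r ≤ 1 := by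
    rw [← hr, Complex.norm_real, Real.norm_eq_abs, abs_of_nonneg hr0] at h1
    exact h1
  have hrpos : 0 < r := by
    rcases hr0.eq_or_lt with h | h
    · rw [← h] at hr
      exact absurd hr.symm (by simpa using hz)
    · exact h
  rw [hz']
  exact ⟨Complex.ofReal_im _, by
    rw [Complex.ofReal_re, sub_nonneg]
    exact (one_le_inv₀ hrpos).2 hr1⟩

/-- The spectrum of `R⁻¹ - 1`, for a positive contraction `R`, is contained in `[0, ∞)`. -/
lemma spec_subset_of_resolvent {R : E →L[ℂ] E} (hpos : R.IsPositive) (hR : ‖R‖ ≤ 1)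
    {T : E →ₗ.[ℂ] E} (hT : ∀ u f, (u, f) ∈ T.graph ↔ R (f + u) = u) :
    spec T ⊆ {z : ℂ | z.im = 0 ∧ 0 ≤ z.re} := by
  intro z hzs
  by_contra hz
  refine hzs ?_
  -- With T = R⁻¹ - 1, formally T - z = (1 - (z + 1)R) R⁻¹. Inverting the first factor gives the
  -- resolvent R (1 - (z + 1)R)⁻¹; at z = -1 it is R itself.
  have hunit : IsUnit (1 - (z + 1) • R) := by
    by_cases h0 : z + 1 = 0
    · simp [h0]
    · have h1 : (z + 1)⁻¹ ∉ spectrum ℂ R :=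
        fun h => hz (nonneg_of_inv_add_one_mem_spectrum hpos hR h0 h)
      rw [spectrum.notMem_iff] at h1
      have h2 : (1 - (z + 1) • R) =
          (algebraMap ℂ (E →L[ℂ] E) (z + 1)) * (algebraMap ℂ (E →L[ℂ] E) (z + 1)⁻¹ - R) := by
        rw [mul_sub, ← map_mul, mul_inv_cancel₀ h0, map_one, Algebra.smul_def]
      rw [h2]
      exact ((IsUnit.mk0 _ h0).map (algebraMap ℂ (E →L[ℂ] E))).mul h1
  obtain ⟨S, hS1, hS2⟩ := isUnit_iff_exists.mp hunit
  have hS1' : ∀ x, S x - (z + 1) • R (S x) = x := fun x => by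
    simpa using DFunLike.congr_fun hS1 x
  have hS2' : ∀ x, S (x - (z + 1) • R x) = x := fun x => by
    simpa using DFunLike.congr_fun hS2 x
  refine ⟨R ∘L S, fun f => ?_, fun u => ?_⟩
  · have hm : (R (S f), S f - R (S f)) ∈ T.graph := (hT _ _).2 (by simp)
    rw [LinearPMap.mem_graph_iff] at hm
    obtain ⟨y, hy, hTy⟩ := hm
    have hdom : (R ∘L S) f ∈ T.domain := by
      rw [comp_apply, ← show (y : E) = R (S f) from hy]
      exact y.2
    refine ⟨hdom, ?_⟩
    have : (⟨(R ∘L S) f, hdom⟩ : T.domain) = y := Subtype.ext hy.symm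
    rw [this, hTy, comp_apply]
    conv_rhs => rw [← hS1' f]
    module
  · have hu : R (T u + u) = u := (hT _ _).1 (T.mem_graph u)
    have h3 : T u - z • (u : E) = (T u + u) - (z + 1) • R (T u + u) := by
      rw [hu]
      module
    rw [comp_apply, h3, hS2', hu]

/-- If `R = J J†` and the quotients `(‖v‖² - ‖J v‖²) / ‖J v‖²` can be arbitrarily small, then `0`
belongs to the spectrum of `R⁻¹ - 1`. -/
lemma zero_mem_spec_of_resolvent {Q : Type*} [NormedAddCommGroup Q] [InnerProductSpace ℂ Q]
    [CompleteSpace Q] (J : Q →L[ℂ] E) (hJ : ‖J‖ ≤ 1)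
    (happ : ∀ ε > 0, ∃ v : Q, J v ≠ 0 ∧ ‖v‖ ^ 2 - ‖J v‖ ^ 2 ≤ ε * ‖J v‖ ^ 2)
    {T : E →ₗ.[ℂ] E} (hT : ∀ u f, (u, f) ∈ T.graph ↔ (J ∘L adjoint J) (f + u) = u) :
    (0 : ℂ) ∈ spec T := by
  rintro ⟨S, hS1, -⟩
  set R : E →L[ℂ] E := J ∘L adjoint J with hRdef
  have hRS : (1 - R) * (1 + S) = 1 := by
    ext f
    obtain ⟨h, hf⟩ := hS1 f
    rw [zero_smul, sub_zero] at hf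
    have h1 : R (f + S f) = S f := by
      have := (hT _ _).1 (T.mem_graph ⟨S f, h⟩)
      rwa [hf] at this
    have : (f + S f) - R (f + S f) = f := by
      rw [h1]
      abel
    simpa using this
  have hRadj : adjoint R = R := (isPositive_self_comp_adjoint J).isSelfAdjoint
  -- A right inverse of the self-adjoint 1 - R becomes a left inverse after taking adjoints, hence a
  -- lower bound.
  have hbound : ∀ x : E, ‖x‖ ≤ ‖1 + S‖ * ‖x - R x‖ := fun x => by
    have h1 : star (1 + S) * (1 - R) = 1 := by
      have := congrArg star hRS
      rw [star_mul, star_one, star_sub, star_one] at this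
      rwa [show star R = R from hRadj] at this
    have h2 : (star (1 + S)) (x - R x) = x := by simpa using DFunLike.congr_fun h1 x
    calc ‖x‖ = ‖(star (1 + S)) (x - R x)‖ := by rw [h2]
      _ ≤ ‖star (1 + S)‖ * ‖x - R x‖ := le_opNorm _ _
      _ = ‖1 + S‖ * ‖x - R x‖ := by rw [norm_star]
  -- With y = J†Jv one has Jv - RJv = J(v - y), ⟪v, y⟫ = ‖Jv‖² and ‖y‖ ≤ ‖Jv‖; expand ‖v - y‖².
  have hkey : ∀ v : Q, ‖J v - R (J v)‖ ^ 2 ≤ ‖v‖ ^ 2 - ‖J v‖ ^ 2 := fun v => by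
    set y := adjoint J (J v) with hy
    have e1 : J v - R (J v) = J (v - y) := by simp [hRdef, hy]
    have e2 : ‖J v - R (J v)‖ ≤ ‖v - y‖ := by
      rw [e1]
      exact (le_opNorm _ _).trans (mul_le_of_le_one_left (norm_nonneg _) hJ)
    have e3 : ‖v - y‖ ^ 2 = ‖v‖ ^ 2 - 2 * ‖J v‖ ^ 2 + ‖y‖ ^ 2 := by
      rw [norm_sub_sq (𝕜 := ℂ), hy, adjoint_inner_right, inner_self_eq_norm_sq]
    have e4 : ‖y‖ ≤ ‖J v‖ := by
      refine (le_opNorm _ _).trans (mul_le_of_le_one_left (norm_nonneg _) ?_)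
      rwa [LinearIsometryEquiv.norm_map]
    have e5 : ‖y‖ ^ 2 ≤ ‖J v‖ ^ 2 := by gcongr
    have e6 : ‖J v - R (J v)‖ ^ 2 ≤ ‖v - y‖ ^ 2 := by gcongr
    linarith
  set C := ‖(1 : E →L[ℂ] E) + S‖ with hC
  have hC0 : 0 ≤ C := norm_nonneg _
  -- This ε makes C²ε < 1/2, also when C = 0, so the two bounds force ‖Jv‖² ≤ ‖Jv‖²/2.
  obtain ⟨v, hv0, hv⟩ := happ (1 / (2 * (C ^ 2 + 1))) (by positivity)
  have hpos : 0 < ‖J v‖ ^ 2 := by positivity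
  have h1 : ‖J v‖ ^ 2 ≤ C ^ 2 * ‖J v - R (J v)‖ ^ 2 := by
    rw [← mul_pow]
    gcongr
    exact hbound _
  have h2 : C ^ 2 * ‖J v - R (J v)‖ ^ 2 ≤ C ^ 2 * (1 / (2 * (C ^ 2 + 1)) * ‖J v‖ ^ 2) := by
    gcongr
    exact (hkey v).trans hv
  have h3 : C ^ 2 * (1 / (2 * (C ^ 2 + 1)) * ‖J v‖ ^ 2)
      = (C ^ 2 / (C ^ 2 + 1)) * (‖J v‖ ^ 2 / 2) := by
    field_simp
  have h4 : C ^ 2 / (C ^ 2 + 1) ≤ 1 := by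
    rw [div_le_one (by positivity)]
    linarith
  nlinarith

end Abstract

lemma specBottom_eq_zero {E : Type*} [NormedAddCommGroup E] [NormedSpace ℂ E] {T : E →ₗ.[ℂ] E}
    (h0 : (0 : ℂ) ∈ spec T) (h : spec T ⊆ {z : ℂ | z.im = 0 ∧ 0 ≤ z.re}) : specBottom T = 0 := by
  refine le_antisymm ((iInf₂_le (0 : ℂ) h0).trans (by simp)) (le_iInf₂ fun z hz => ?_)
  exact_mod_cast (h hz).2

end Anderson

end

noncomputable section

namespace Anderson

open Filter Topology ContinuousLinearMap

/-! ### The form domain as a Hilbert space -/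

section FormDomain

variable {n d : ℕ}

/-- The Hilbert space of the triples `(u, w, g)`, where `u` is a candidate for an element of the form
domain, `w` for `√W u`, and `g` for the weak gradient of `u`. -/
abbrev FormSpace (n d : ℕ) : Type := PiLp 2 fun _ : Option (Option (Fin n × Fin d)) => L2 n d

lemma continuous_integral_smul {ψ : Config n d → ℝ} (hψ : MemLp ψ 2 volume) :
    Continuous fun u : L2 n d => ∫ x, ψ x • u x := by
  have hψ' : MemLp (fun x => (ψ x : ℂ)) 2 volume := hψ.ofReal
  have h : ∀ u : L2 n d, ∫ x, ψ x • u x = ⟪hψ'.toLp _, u⟫_ℂ := fun u => by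
    rw [L2.inner_def]
    refine integral_congr_ae ?_
    filter_upwards [hψ'.coeFn_toLp] with x hx
    rw [hx]
    simp [mul_comm]
  simp_rw [h]
  fun_prop

lemma isClosed_isWeakGrad {X : Type*} [TopologicalSpace X] {u : X → L2 n d}
    {g : Fin n × Fin d → X → L2 n d} (hu : Continuous u) (hg : ∀ p, Continuous (g p)) :
    IsClosed {q | IsWeakGrad (u q) fun p => g p q} := by
  simp only [IsWeakGrad, Set.ofPred_forall]
  refine isClosed_iInter fun p => isClosed_iInter fun φ => isClosed_iInter fun hφ =>
    isClosed_iInter fun hc => ?_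
  have hcont : Continuous fun x => fderiv ℝ φ x (unitVec p) :=
    (hφ.continuous_fderiv (by simp)).clm_apply continuous_const
  have hcs : HasCompactSupport fun x => fderiv ℝ φ x (unitVec p) :=
    (hc.fderiv (𝕜 := ℝ)).comp_left (g := fun L : Config n d →L[ℝ] ℝ => L (unitVec p)) (by simp)
  exact isClosed_eq
    ((continuous_integral_smul (hcont.memLp_of_hasCompactSupport hcs)).comp hu)
    ((continuous_integral_smul (hφ.continuous.memLp_of_hasCompactSupport hc)).comp (hg p)).neg

lemma exists_seq_tendsto_ae_of_tendsto_Lp {u : ℕ → L2 n d} {v : L2 n d}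
    (h : Tendsto u atTop (𝓝 v)) : ∃ ns : ℕ → ℕ, StrictMono ns ∧
      ∀ᵐ x, Tendsto (fun i => u (ns i) x) atTop (𝓝 (v x)) :=
  (tendstoInMeasure_of_tendsto_Lp h).exists_seq_tendsto_ae

/-- L² limits are almost everywhere limits along a subsequence, so the pointwise relation survives
without any regularity of `W`. The second subsequence is extracted from the first, so that both
components converge along it. -/
lemma isClosed_isSqrtMul (W : Config n d → ℝ) {X : Type*} [TopologicalSpace X]
    [FirstCountableTopology X] {u w : X → L2 n d} (hu : Continuous u) (hw : Continuous w) :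
    IsClosed {q | IsSqrtMul W (u q) (w q)} := by
  refine IsSeqClosed.isClosed fun q q₀ hq hlim => ?_
  obtain ⟨ns, hns, h1⟩ :=
    exists_seq_tendsto_ae_of_tendsto_Lp ((hu.tendsto q₀).comp hlim)
  obtain ⟨ms, hms, h2⟩ := exists_seq_tendsto_ae_of_tendsto_Lp
    ((hw.tendsto q₀).comp (hlim.comp hns.tendsto_atTop))
  have h3 : ∀ᵐ x, ∀ i, w (q i) x = (Real.sqrt (W x) : ℂ) * u (q i) x :=
    ae_all_iff.2 fun i => hq i
  change IsSqrtMul W (u q₀) (w q₀)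
  unfold IsSqrtMul
  filter_upwards [h1, h2, h3] with x h1 h2 h3
  refine tendsto_nhds_unique h2 ?_
  have := (h1.comp hms.tendsto_atTop).const_mul (Real.sqrt (W x) : ℂ)
  refine this.congr fun i => ?_
  exact (h3 _).symm

/-- The form domain of `-Δ + W`, realised as a subspace of `FormSpace n d`. -/
def formDomain (W : Config n d → ℝ) : Submodule ℂ (FormSpace n d) where
  carrier := {q | IsWeakGrad (q none) (fun p => q (some (some p))) ∧
    IsSqrtMul W (q none) (q (some none))}
  add_mem' := fun hq hq' => ⟨hq.1.add hq'.1, hq.2.add hq'.2⟩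
  zero_mem' := ⟨IsWeakGrad.zero, IsSqrtMul.zero W⟩
  smul_mem' := fun c _ hq => ⟨hq.1.smul c, hq.2.smul c⟩

lemma isClosed_formDomain (W : Config n d → ℝ) :
    IsClosed (formDomain W : Set (FormSpace n d)) :=
  (isClosed_isWeakGrad (by fun_prop) fun p => by fun_prop).inter
    (isClosed_isSqrtMul W (by fun_prop) (by fun_prop))

instance (W : Config n d → ℝ) : CompleteSpace (formDomain W) :=
  (isClosed_formDomain W).completeSpace_coe

/-- The inclusion of the form domain into `L²`. -/
def formIncl (W : Config n d → ℝ) : formDomain W →L[ℂ] L2 n d :=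
  (PiLp.proj 2 (fun _ : Option (Option (Fin n × Fin d)) => L2 n d) none : FormSpace n d →L[ℂ] L2 n d)
    ∘L (formDomain W).subtypeL

lemma formIncl_apply {W : Config n d → ℝ} (v : formDomain W) :
    formIncl W v = (v : FormSpace n d) none := rfl

lemma norm_formIncl_le (W : Config n d → ℝ) : ‖formIncl W‖ ≤ 1 :=
  opNorm_le_bound _ zero_le_one fun v => by
    rw [one_mul, formIncl_apply]
    exact PiLp.norm_apply_le (v : FormSpace n d) none

lemma inner_formDomain {W : Config n d → ℝ} (v q : formDomain W) :
    ⟪v, q⟫_ℂ = ⟪formIncl W v, formIncl W q⟫_ℂ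
      + (∑ p, ⟪(v : FormSpace n d) (some (some p)), (q : FormSpace n d) (some (some p))⟫_ℂ
        + ⟪(v : FormSpace n d) (some none), (q : FormSpace n d) (some none)⟫_ℂ) := by
  rw [Submodule.coe_inner, PiLp.inner_apply, Fintype.sum_option, Fintype.sum_option,
    add_comm (inner ℂ ((v : FormSpace n d) (some none)) _)]
  rfl

/-- Adding ⟪v, u⟫ to both sides of a(v, u) = ⟪v, f⟫ turns the left side into the inner product of
the form domain. The equation then says that the triple over u is J†(f + u). -/
lemma mem_schrodingerGraph_iff (W : Config n d → ℝ) (u f : L2 n d) :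
    (u, f) ∈ schrodingerGraph W ↔ (formIncl W ∘L adjoint (formIncl W)) (f + u) = u := by
  constructor
  · rintro ⟨g, w, hg, hw, H⟩
    let q₀ : FormSpace n d := WithLp.toLp 2 fun o =>
      match o with
      | none => u
      | some none => w
      | some (some p) => g p
    let q : formDomain W := ⟨q₀, hg, hw⟩
    have hq : adjoint (formIncl W) (f + u) = q := by
      refine ext_inner_left ℂ fun v => ?_
      rw [adjoint_inner_right, inner_add_right, inner_formDomain v q, add_comm]
      exact congrArg _ (H _ _ _ v.2.1 v.2.2).symm
    rw [comp_apply, hq]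
    rfl
  · intro h
    set q := adjoint (formIncl W) (f + u) with hq
    have hqu : (q : FormSpace n d) none = u := h
    refine ⟨fun p => (q : FormSpace n d) (some (some p)), (q : FormSpace n d) (some none),
      ?_, ?_, fun v g s hv hs => ?_⟩
    · have := q.2.1
      rwa [hqu] at this
    · have := q.2.2
      rwa [hqu] at this
    · let v₀ : FormSpace n d := WithLp.toLp 2 fun o =>
        match o with
        | none => v
        | some none => s
        | some (some p) => g p
      let v' : formDomain W := ⟨v₀, hv, hs⟩
      have e1 : ⟪v', q⟫_ℂ = ⟪formIncl W v', f + u⟫_ℂ := by rw [hq, adjoint_inner_right]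
      rw [inner_formDomain, inner_add_right, add_comm ⟪formIncl W v', f⟫_ℂ] at e1
      have e2 : formIncl W q = u := h
      rw [e2] at e1
      exact add_left_cancel e1

/-! ### Test functions -/

lemma norm_sq_eq_integral_of_ae {u : L2 n d} {φ : Config n d → ℝ}
    (h : u =ᵐ[volume] fun x => (φ x : ℂ)) : ‖u‖ ^ 2 = ∫ x, φ x ^ 2 := by
  have h1 : ⟪u, u⟫_ℂ = ((∫ x, φ x ^ 2 : ℝ) : ℂ) := by
    rw [L2.inner_def, ← integral_complex_ofReal]
    refine integral_congr_ae ?_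
    filter_upwards [h] with x hx
    rw [hx, RCLike.inner_apply, Complex.conj_ofReal]
    push_cast
    ring
  rw [inner_self_eq_norm_sq_to_K] at h1
  exact Complex.ofReal_injective (by rw [← h1]; push_cast; rfl)

lemma isWeakGrad_of_contDiff {φ : Config n d → ℝ} (hφ : ContDiff ℝ (⊤ : ℕ∞) φ)
    (hc : HasCompactSupport φ) {u : L2 n d} {g : Fin n × Fin d → L2 n d}
    (hu : u =ᵐ[volume] fun x => (φ x : ℂ))
    (hg : ∀ p, g p =ᵐ[volume] fun x => (fderiv ℝ φ x (unitVec p) : ℂ)) : IsWeakGrad u g := by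
  intro p ψ hψ hψc
  have hcont : ∀ {χ : Config n d → ℝ}, ContDiff ℝ (⊤ : ℕ∞) χ →
      Continuous fun x => fderiv ℝ χ x (unitVec p) := fun hχ =>
    (hχ.continuous_fderiv (by simp)).clm_apply continuous_const
  have e1 : ∫ x, (fderiv ℝ ψ x (unitVec p)) • u x
      = ((∫ x, φ x * fderiv ℝ ψ x (unitVec p) : ℝ) : ℂ) := by
    rw [← integral_complex_ofReal]
    refine integral_congr_ae ?_
    filter_upwards [hu] with x hx
    rw [hx]
    simp [mul_comm]
  have e2 : ∫ x, ψ x • g p x = ((∫ x, fderiv ℝ φ x (unitVec p) * ψ x : ℝ) : ℂ) := by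
    rw [← integral_complex_ofReal]
    refine integral_congr_ae ?_
    filter_upwards [hg p] with x hx
    rw [hx]
    simp [mul_comm]
  rw [e1, e2, integral_mul_fderiv_eq_neg_fderiv_mul_of_integrable, Complex.ofReal_neg]
  · exact ((hcont hφ).mul hψ.continuous).integrable_of_hasCompactSupport hψc.mul_left
  · exact (hφ.continuous.mul (hcont hψ)).integrable_of_hasCompactSupport hc.mul_right
  · exact (hφ.continuous.mul hψ.continuous).integrable_of_hasCompactSupport hc.mul_right
  · exact fun x _ => hφ.differentiable (by simp) x
  · exact fun x _ => hψ.differentiable (by simp) x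

/-- The square is at most φ²|W|. `Real.sqrt` vanishes on negative numbers, so no sign of `W` is
needed. -/
lemma memLp_sqrt_mul {W : Config n d → ℝ} (hW : LocallyIntegrable W volume) {φ : Config n d → ℝ}
    (hφ : Continuous φ) (hc : HasCompactSupport φ) :
    MemLp (fun x => Real.sqrt (W x) * φ x) 2 volume := by
  have hm : AEStronglyMeasurable (fun x => Real.sqrt (W x) * φ x) volume :=
    (Real.continuous_sqrt.comp_aestronglyMeasurable hW.aestronglyMeasurable).mul
      hφ.aestronglyMeasurable
  rw [memLp_two_iff_integrable_sq hm]
  have hint : Integrable (fun x => (φ x ^ 2) • W x) volume :=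
    hW.integrable_smul_left_of_hasCompactSupport (hφ.pow 2)
      (hc.comp_left (g := fun t : ℝ => t ^ 2) (by simp))
  refine hint.mono (hm.pow 2) (ae_of_all _ fun x => ?_)
  rw [mul_pow, norm_mul, smul_eq_mul, norm_mul, mul_comm]
  gcongr
  rw [Real.norm_of_nonneg (sq_nonneg _)]
  rcases le_total 0 (W x) with h | h
  · rw [Real.sq_sqrt h]
    exact le_abs_self _
  · rw [Real.sqrt_eq_zero_of_nonpos h]
    simp

lemma exists_mem_formDomain {W : Config n d → ℝ} (hW : LocallyIntegrable W volume)
    {φ : Config n d → ℝ} (hφ : ContDiff ℝ (⊤ : ℕ∞) φ) (hc : HasCompactSupport φ) :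
    ∃ v : formDomain W, formIncl W v =ᵐ[volume] (fun x => (φ x : ℂ)) ∧
      ‖v‖ ^ 2 - ‖formIncl W v‖ ^ 2 = (∑ p, ∫ x, (fderiv ℝ φ x (unitVec p)) ^ 2)
        + ∫ x, (Real.sqrt (W x) * φ x) ^ 2 := by
  have hcont : ∀ p, Continuous fun x => fderiv ℝ φ x (unitVec p) := fun p =>
    (hφ.continuous_fderiv (by simp)).clm_apply continuous_const
  have hcs : ∀ p, HasCompactSupport fun x => fderiv ℝ φ x (unitVec p) := fun p =>
    (hc.fderiv (𝕜 := ℝ)).comp_left (g := fun L : Config n d →L[ℝ] ℝ => L (unitVec p)) (by simp)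
  have hu := (hφ.continuous.memLp_of_hasCompactSupport (μ := volume) (p := 2) hc).ofReal (K := ℂ)
  have hg := fun p =>
    ((hcont p).memLp_of_hasCompactSupport (μ := volume) (p := 2) (hcs p)).ofReal (K := ℂ)
  have hw := (memLp_sqrt_mul hW hφ.continuous hc).ofReal (K := ℂ)
  let q : FormSpace n d := WithLp.toLp 2 fun o =>
    match o with
    | none => hu.toLp _
    | some none => hw.toLp _
    | some (some p) => (hg p).toLp _
  have hq : q ∈ formDomain W := by
    refine ⟨isWeakGrad_of_contDiff hφ hc hu.coeFn_toLp fun p => (hg p).coeFn_toLp, ?_⟩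
    change hw.toLp _ =ᵐ[volume] fun x => (Real.sqrt (W x) : ℂ) * hu.toLp _ x
    filter_upwards [hw.coeFn_toLp, hu.coeFn_toLp] with x h1 h2
    rw [h1, h2]
    simp
  refine ⟨⟨q, hq⟩, hu.coeFn_toLp, ?_⟩
  have e : ‖(⟨q, hq⟩ : formDomain W)‖ ^ 2 = ‖hu.toLp _‖ ^ 2 + (‖hw.toLp _‖ ^ 2
      + ∑ p, ‖(hg p).toLp _‖ ^ 2) := by
    rw [Submodule.coe_norm, PiLp.norm_sq_eq_of_L2, Fintype.sum_option, Fintype.sum_option]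
  rw [e, norm_sq_eq_integral_of_ae (φ := fun x => Real.sqrt (W x) * φ x) hw.coeFn_toLp,
    Finset.sum_congr rfl fun p _ => norm_sq_eq_integral_of_ae
      (φ := fun x => fderiv ℝ φ x (unitVec p)) (hg p).coeFn_toLp]
  change ‖hu.toLp _‖ ^ 2 + _ - ‖hu.toLp _‖ ^ 2 = _
  ring

/-! ### Density of the form domain and the spectrum of `schrodinger W` -/

lemma injective_adjoint_formIncl {W : Config n d → ℝ} (hW : LocallyIntegrable W volume)
    {f : L2 n d} (hf : adjoint (formIncl W) f = 0) : f = 0 := by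
  rw [Lp.eq_zero_iff_ae_eq_zero]
  refine ae_eq_zero_of_integral_contDiff_smul_eq_zero
    ((Lp.memLp f).locallyIntegrable one_le_two) fun φ hφ hc => ?_
  obtain ⟨v, hv, -⟩ := exists_mem_formDomain hW hφ hc
  have h1 : ⟪formIncl W v, f⟫_ℂ = 0 := by rw [← adjoint_inner_right, hf, inner_zero_right]
  rw [L2.inner_def] at h1
  rw [← h1]
  refine integral_congr_ae ?_
  filter_upwards [hv] with x hx
  rw [hx]
  simp [mul_comm]

/-- `Submodule.toLinearPMap` has the given graph only if that graph is single-valued. If (0, f) lies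
in it, then J J†f = 0, so J†f = 0, and f = 0 by density of the test functions. -/
lemma mem_graph_schrodinger_iff {W : Config n d → ℝ} (hW : LocallyIntegrable W volume)
    (u f : L2 n d) : (u, f) ∈ (schrodinger W).graph ↔
      (formIncl W ∘L adjoint (formIncl W)) (f + u) = u := by
  rw [schrodinger, Submodule.toLinearPMap_graph_eq, mem_schrodingerGraph_iff]
  rintro ⟨u, f⟩ hx (rfl : u = 0)
  rw [mem_schrodingerGraph_iff, add_zero] at hx
  refine injective_adjoint_formIncl hW ?_
  have h1 : ⟪adjoint (formIncl W) f, adjoint (formIncl W) f⟫_ℂ = 0 := by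
    rw [adjoint_inner_left, ← comp_apply, hx, inner_zero_right]
  exact inner_self_eq_zero.1 h1

theorem spec_schrodinger_subset {W : Config n d → ℝ} (hW : LocallyIntegrable W volume) :
    spec (schrodinger W) ⊆ {z : ℂ | z.im = 0 ∧ 0 ≤ z.re} := by
  refine spec_subset_of_resolvent (isPositive_self_comp_adjoint (formIncl W)) ?_
    (mem_graph_schrodinger_iff hW)
  refine (opNorm_comp_le _ _).trans ?_
  rw [LinearIsometryEquiv.norm_map]
  exact mul_le_one₀ (norm_formIncl_le W) (norm_nonneg (formIncl W)) (norm_formIncl_le W)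

theorem zero_mem_spec_schrodinger {W : Config n d → ℝ} (hW : LocallyIntegrable W volume)
    (h : ∀ ε > 0, ∃ φ : Config n d → ℝ, ContDiff ℝ (⊤ : ℕ∞) φ ∧ HasCompactSupport φ ∧
      0 < ∫ x, φ x ^ 2 ∧
      (∑ p, ∫ x, (fderiv ℝ φ x (unitVec p)) ^ 2) + ∫ x, (Real.sqrt (W x) * φ x) ^ 2
        ≤ ε * ∫ x, φ x ^ 2) :
    (0 : ℂ) ∈ spec (schrodinger W) := by
  refine zero_mem_spec_of_resolvent (formIncl W) (norm_formIncl_le W) (fun ε hε => ?_)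
    (mem_graph_schrodinger_iff hW)
  obtain ⟨φ, hφ, hc, hpos, hle⟩ := h ε hε
  obtain ⟨v, hv, he⟩ := exists_mem_formDomain hW hφ hc
  have hnorm := norm_sq_eq_integral_of_ae hv
  refine ⟨v, fun h0 => ?_, by rw [he, hnorm]; exact hle⟩
  rw [h0, norm_zero, zero_pow two_ne_zero] at hnorm
  exact hpos.ne hnorm

end FormDomain

end Anderson

end

noncomputable section

namespace Anderson

open Filter Topology Set

/-! ### Local integrability of the potential -/

section Integrability

variable {n d : ℕ}

/-- Integrating out the other particles over a box costs only the volumes of their sides; this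
reduces one-particle integrals to (ℝ^d). -/
lemma map_eval_restrict_pi (s : Fin n → Set (Fin d → ℝ)) (i : Fin n)
    (hs : ∀ j, volume (s j) ≠ ⊤) :
    ((volume : Measure (Config n d)).restrict (univ.pi s)).map (Function.eval i)
      = (∏ j ∈ Finset.univ.erase i, volume (s j)) • volume.restrict (s i) := by
  have : ∀ j, IsFiniteMeasure (volume.restrict (s j)) := fun j =>
    isFiniteMeasure_restrict.2 (hs j)
  rw [volume_pi, Measure.restrict_pi_pi, Measure.pi_map_eval]
  simp only [Measure.restrict_apply_univ]

lemma integrableOn_comp_eval {G : (Fin d → ℝ) → ℝ} {s : Fin n → Set (Fin d → ℝ)} {i : Fin n}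
    (hs : ∀ j, volume (s j) ≠ ⊤) (hG : IntegrableOn G (s i)) :
    IntegrableOn (fun x : Config n d => G (x i)) (univ.pi s) := by
  have h : Integrable G
      (((volume : Measure (Config n d)).restrict (univ.pi s)).map (Function.eval i)) := by
    rw [map_eval_restrict_pi s i hs]
    exact hG.smul_measure (ENNReal.prod_ne_top fun j _ => hs j)
  exact h.comp_measurable (measurable_pi_apply i)

lemma setIntegral_comp_eval {G : (Fin d → ℝ) → ℝ} {s : Fin n → Set (Fin d → ℝ)} {i : Fin n}
    (hs : ∀ j, volume (s j) ≠ ⊤) (hG : IntegrableOn G (s i)) :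
    ∫ x in univ.pi s, G (x i)
      = (∏ j ∈ Finset.univ.erase i, volume (s j)).toReal * ∫ y in s i, G y := by
  have h : AEStronglyMeasurable G
      (((volume : Measure (Config n d)).restrict (univ.pi s)).map (Function.eval i)) := by
    rw [map_eval_restrict_pi s i hs]
    exact hG.aestronglyMeasurable.smul_measure _
  have := integral_map (μ := (volume : Measure (Config n d)).restrict (univ.pi s))
    (φ := Function.eval i) (measurable_pi_apply i).aemeasurable h
  rw [map_eval_restrict_pi s i hs, integral_smul_measure, smul_eq_mul] at this
  exact this.symm

lemma locallyIntegrable_comp_eval {G : (Fin d → ℝ) → ℝ} (hG : LocallyIntegrable G volume)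
    (i : Fin n) : LocallyIntegrable (fun x : Config n d => G (x i)) volume := by
  rw [locallyIntegrable_iff]
  intro K hK
  obtain ⟨R, hR0, hR⟩ := hK.isBounded.subset_closedBall_lt 0 0
  refine IntegrableOn.mono_set ?_ hR
  rw [closedBall_pi _ hR0.le]
  exact integrableOn_comp_eval (fun j => measure_closedBall_lt_top.ne)
    (hG.integrableOn_isCompact (isCompact_closedBall _ _))

/-- The linear involution of `(ℝ^d)^n` which replaces `x_i` by `x_j - x_i`. -/
def relativeCoord (i j : Fin n) (h : i ≠ j) : Config n d ≃ₗ[ℝ] Config n d :=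
  LinearEquiv.ofInvolutive
    { toFun := fun x k => if k = i then x j - x i else x k
      map_add' := fun x y => by
        ext k l
        by_cases hk : k = i
        · simp only [hk, if_true, Pi.add_apply, Pi.sub_apply]
          ring
        · simp [hk]
      map_smul' := fun c x => by
        ext k l
        by_cases hk : k = i
        · simp [hk, mul_sub]
        · simp [hk] }
    (fun x => by
      ext k l
      by_cases hk : k = i
      · simp [hk, h.symm]
      · simp [hk])

lemma relativeCoord_apply_self {i j : Fin n} (h : i ≠ j) (x : Config n d) :
    relativeCoord i j h x i = x j - x i := by
  change (if i = i then x j - x i else x i) = x j - x i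
  rw [if_pos rfl]

lemma locallyIntegrable_comp_linearEquiv {F : Config n d → ℝ} (hF : LocallyIntegrable F volume)
    (e : Config n d ≃ₗ[ℝ] Config n d) : LocallyIntegrable (fun x => F (e x)) volume := by
  rw [locallyIntegrable_iff]
  intro K hK
  have he : MeasurableEmbedding e :=
    e.toContinuousLinearEquiv.toHomeomorph.measurableEmbedding
  have h1 : IntegrableOn F (e '' K) (Measure.map e volume) := by
    have := Measure.map_linearMap_addHaar_eq_smul_addHaar (volume : Measure (Config n d))
      (f := (e : Config n d →ₗ[ℝ] Config n d)) e.isUnit_det'.ne_zero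
    rw [show (e : Config n d → Config n d) = (e : Config n d →ₗ[ℝ] Config n d) from rfl, this]
    rw [IntegrableOn, Measure.restrict_smul]
    exact Integrable.smul_measure (hF.integrableOn_isCompact
      (hK.image e.toContinuousLinearEquiv.continuous)) ENNReal.ofReal_ne_top
  rw [he.integrableOn_map_iff, preimage_image_eq _ e.injective] at h1
  exact h1

/-- In polar coordinates for the max-norm the radial density y^(d-1) is bounded on bounded
intervals. -/
lemma locallyIntegrable_comp_norm (hd : 1 ≤ d) {U : ℝ → ℝ} (hU : LocallyIntegrable U volume) :
    LocallyIntegrable (fun x : Fin d → ℝ => U ‖x‖) volume := by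
  have : Nonempty (Fin d) := ⟨⟨0, hd⟩⟩
  rw [locallyIntegrable_iff]
  intro K hK
  obtain ⟨R, hR⟩ := hK.isBounded.subset_ball 0
  refine IntegrableOn.mono_set ?_ hR
  rw [← integrable_indicator_iff measurableSet_ball]
  have h1 : (Metric.ball (0 : Fin d → ℝ) R).indicator (fun x => U ‖x‖)
      = fun x => (Iio R).indicator U ‖x‖ := by
    ext x
    simp [indicator]
  rw [h1, integrable_fun_norm_addHaar]
  have h2 : IntegrableOn (fun y : ℝ => y ^ (Module.finrank ℝ (Fin d → ℝ) - 1) • U y) (Icc 0 R) :=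
    (hU.integrableOn_isCompact isCompact_Icc).continuousOn_smul
      (by fun_prop) isCompact_Icc
  have h3 : (fun y : ℝ => y ^ (Module.finrank ℝ (Fin d → ℝ) - 1) • (Iio R).indicator U y)
      = (Iio R).indicator fun y : ℝ => y ^ (Module.finrank ℝ (Fin d → ℝ) - 1) • U y := by
    ext y
    by_cases hy : y ∈ Iio R <;> simp [hy]
  rw [h3, IntegrableOn, integrable_indicator_iff measurableSet_Iio, IntegrableOn,
    Measure.restrict_restrict measurableSet_Iio]
  exact h2.mono_set fun y hy => ⟨hy.2.le, hy.1.le⟩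

lemma locallyIntegrable_interaction (hd : 1 ≤ d) {U : ℝ → ℝ} (hU : LocallyIntegrable U volume) :
    LocallyIntegrable (interaction U : Config n d → ℝ) volume := by
  refine locallyIntegrable_finsetSum _ fun i _ => locallyIntegrable_finsetSum _ fun j hj => ?_
  have hij : j ≠ i := (Finset.mem_Ioi.1 hj).ne'
  refine (locallyIntegrable_comp_linearEquiv
    (locallyIntegrable_comp_eval (locallyIntegrable_comp_norm hd hU) j)
    (relativeCoord j i hij)).congr (ae_of_all _ fun x => ?_)
  simp only [relativeCoord_apply_self]

lemma locallyIntegrable_external {V : (Fin d → ℝ) → ℝ} (hV : LocallyIntegrable V volume) :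
    LocallyIntegrable (external V : Config n d → ℝ) volume :=
  locallyIntegrable_finsetSum _ fun i _ => locallyIntegrable_comp_eval hV i

end Integrability

/-! ### Spread-out test functions -/

section Energy

variable {n d : ℕ}

/-- After rescaling, |a| ≤ t⁻¹ + t a² with a = V(t² y) on the unit box. The first term contributes
O(t⁻¹), the second t · t^(-2d) ∫ V². -/
lemma integral_abs_comp_eval_mul_sq_le (hd : 1 ≤ d) {V : (Fin d → ℝ) → ℝ} (hV : MemLp V 2 volume)
    {φ : Config n d → ℝ} (hφ1 : ∀ x, |φ x| ≤ 1) {c : Config n d}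
    (hsupp : ∀ x, φ x ≠ 0 → x ∈ Metric.ball c 1) (j : Fin n) :
    ∃ K : ℝ, ∀ t : ℝ, 1 ≤ t →
      ∫ x, |V (x j)| * φ ((t ^ 2)⁻¹ • x) ^ 2
        ≤ (t ^ 2) ^ (Module.finrank ℝ (Config n d)) * (t⁻¹ * K) := by
  set s : Fin n → Set (Fin d → ℝ) := fun i => Metric.ball (c i) 1 with hs
  have hsf : ∀ i, volume (s i) ≠ ⊤ := fun i => measure_ball_lt_top.ne
  set C := (∏ i ∈ Finset.univ.erase j, volume (s i)).toReal with hC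
  refine ⟨C * (volume.real (s j) + ∫ y, V y ^ 2), fun t ht => ?_⟩
  have ht0 : 0 < t := by linarith
  have hV2 : Integrable (fun y => V y ^ 2) volume := hV.integrable_sq
  have hV2s : Integrable (fun y => V (t ^ 2 • y) ^ 2) volume := by
    exact hV2.comp_smul (by positivity)
  have e1 : ∫ x, |V (x j)| * φ ((t ^ 2)⁻¹ • x) ^ 2
      = (t ^ 2) ^ (Module.finrank ℝ (Config n d)) *
        ∫ x : Config n d, |V (t ^ 2 • x j)| * φ x ^ 2 := by
    have := Measure.integral_comp_inv_smul (volume : Measure (Config n d))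
      (fun x => |V (t ^ 2 • x j)| * φ x ^ 2) (t ^ 2)
    rw [abs_of_nonneg (by positivity), smul_eq_mul] at this
    rw [← this]
    refine integral_congr_ae (ae_of_all _ fun x => ?_)
    simp only [Pi.smul_apply]
    rw [smul_inv_smul₀ (by positivity)]
  have hG : IntegrableOn (fun y => t⁻¹ + t * V (t ^ 2 • y) ^ 2) (s j) :=
    (integrableOn_const (hsf j)).add (hV2s.const_mul t).integrableOn
  have hmeas : MeasurableSet (univ.pi s) :=
    MeasurableSet.univ_pi fun i => measurableSet_ball
  have e2 : ∫ x : Config n d, |V (t ^ 2 • x j)| * φ x ^ 2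
      ≤ ∫ x in univ.pi s, (t⁻¹ + t * V (t ^ 2 • x j) ^ 2) := by
    rw [← integral_indicator hmeas]
    refine integral_mono_of_nonneg (ae_of_all _ fun x => by positivity)
      ((integrable_indicator_iff hmeas).2 (integrableOn_comp_eval hsf hG))
      (ae_of_all _ fun x => ?_)
    dsimp only
    by_cases hx : φ x = 0
    · rw [hx, zero_pow two_ne_zero, mul_zero]
      exact indicator_nonneg (fun x _ => by positivity) x
    · have hx' : x ∈ univ.pi s := by
        rw [hs, ← ball_pi _ one_pos]
        exact hsupp x hx
      rw [indicator_of_mem hx']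
      have h1 : φ x ^ 2 ≤ 1 := (sq_le_one_iff_abs_le_one _).2 (hφ1 x)
      set a := V (t ^ 2 • x j)
      have h2 : |a| ≤ t⁻¹ + t * a ^ 2 := by
        have h3 : 0 ≤ t * (t⁻¹ - |a|) ^ 2 := by positivity
        have h4 : t * (t⁻¹ - |a|) ^ 2 = t⁻¹ - 2 * |a| + t * a ^ 2 := by
          rw [sub_sq, sq_abs]
          field_simp
        have := abs_nonneg a
        linarith
      exact (mul_le_of_le_one_right (abs_nonneg a) h1).trans h2
  have e3 : ∫ y in s j, (t⁻¹ + t * V (t ^ 2 • y) ^ 2)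
      ≤ t⁻¹ * (volume.real (s j) + ∫ y, V y ^ 2) := by
    have hconst : IntegrableOn (fun _ => t⁻¹) (s j) volume := integrableOn_const (hsf j)
    rw [integral_add hconst (hV2s.const_mul t).integrableOn,
      setIntegral_const, smul_eq_mul, mul_add, mul_comm]
    gcongr
    have h1 : ∫ y in s j, t * V (t ^ 2 • y) ^ 2 ≤ ∫ y, t * V (t ^ 2 • y) ^ 2 :=
      setIntegral_le_integral (hV2s.const_mul t) (ae_of_all _ fun y => by positivity)
    refine h1.trans ?_
    rw [integral_const_mul, Measure.integral_comp_smul volume (fun y => V y ^ 2),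
      abs_of_nonneg (by positivity), smul_eq_mul, ← mul_assoc]
    have hI : 0 ≤ ∫ y, V y ^ 2 := integral_nonneg fun y => sq_nonneg _
    refine mul_le_mul_of_nonneg_right ?_ hI
    -- Here d ≥ 1 enters: t · t^(-2d) ≤ t⁻¹.
    have h2 : t ^ 2 ≤ (t ^ 2) ^ Module.finrank ℝ (Fin d → ℝ) := by
      rw [Module.finrank_fin_fun]
      exact le_self_pow₀ (one_le_pow₀ ht) (by omega)
    calc t * ((t ^ 2) ^ Module.finrank ℝ (Fin d → ℝ))⁻¹ ≤ t * (t ^ 2)⁻¹ := by gcongr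
      _ = t⁻¹ := by field_simp
  rw [e1]
  refine mul_le_mul_of_nonneg_left (e2.trans ?_) (by positivity)
  rw [setIntegral_comp_eval hsf hG, mul_left_comm]
  exact mul_le_mul_of_nonneg_left e3 ENNReal.toReal_nonneg

lemma integrable_abs_comp_eval_mul_sq {V : (Fin d → ℝ) → ℝ} (hV : MemLp V 2 volume)
    {φ : Config n d → ℝ} (hφ : Continuous φ) (hc : HasCompactSupport φ) (j : Fin n) :
    Integrable fun x : Config n d => |V (x j)| * φ x ^ 2 := by
  have h1 : LocallyIntegrable (fun y => |V y|) volume := hV.norm.locallyIntegrable one_le_two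
  have h2 : Integrable (fun x : Config n d => φ x ^ 2 • |V (x j)|) volume :=
    (locallyIntegrable_comp_eval h1 j).integrable_smul_left_of_hasCompactSupport
      (hφ.pow 2) (hc.comp_left (g := fun t : ℝ => t ^ 2) (by simp))
  simpa only [smul_eq_mul, mul_comm] using h2

lemma fderiv_comp_const_smul_apply {φ : Config n d → ℝ} (hφ : Differentiable ℝ φ) (a : ℝ)
    (x e : Config n d) : fderiv ℝ (fun x => φ (a • x)) x e = a * fderiv ℝ φ (a • x) e := by
  have h := ((hφ (a • x)).hasFDerivAt).comp x ((hasFDerivAt_id x).const_smul a)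
  rw [show (fun x => φ (a • x)) = φ ∘ HSMul.hSMul a from rfl, h.fderiv]
  simp

/-- The centre of the `j`-th particle of the test functions. -/
def spreadCenter (n d : ℕ) : Config n d := fun j _ => 3 * (j : ℝ)

/-- Centres at mutual distance at least 3 and radius 1 leave a gap of at least 1 in the first
coordinate, hence at least s > r₀ after dilation. -/
lemma interaction_eq_zero_of_mem_ball (hd : 1 ≤ d) {U : ℝ → ℝ} {r₀ s : ℝ}
    (hU : ∀ x y : Fin d → ℝ, r₀ < ‖x - y‖ → U ‖x - y‖ = 0) (hs : r₀ < s) (hs0 : 0 < s)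
    {x : Config n d} (hx : s⁻¹ • x ∈ Metric.ball (spreadCenter n d) 1) :
    interaction U x = 0 := by
  refine Finset.sum_eq_zero fun i _ => Finset.sum_eq_zero fun j hj => hU _ _ (hs.trans_le ?_)
  have hij : (i : ℝ) + 1 ≤ j := by exact_mod_cast (Finset.mem_Ioi.1 hj)
  have hcoord : ∀ k : Fin n, |s⁻¹ * x k ⟨0, hd⟩ - 3 * k| < 1 := fun k =>
    ((norm_le_pi_norm _ _).trans (norm_le_pi_norm (s⁻¹ • x - spreadCenter n d) k)).trans_lt
      (mem_ball_iff_norm.1 hx)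
  have h1 := abs_lt.1 (hcoord i)
  have h2 := abs_lt.1 (hcoord j)
  have h3 : 1 ≤ s⁻¹ * (x j ⟨0, hd⟩ - x i ⟨0, hd⟩) := by
    rw [mul_sub]
    linarith [h1.2, h2.1]
  have h4 : s ≤ x j ⟨0, hd⟩ - x i ⟨0, hd⟩ := by
    rw [inv_mul_eq_div, le_div_iff₀ hs0, one_mul] at h3
    exact h3
  calc s ≤ |(x i - x j) ⟨0, hd⟩| := by
        rw [Pi.sub_apply, abs_sub_comm]
        exact h4.trans (le_abs_self _)
    _ ≤ ‖x i - x j‖ := norm_le_pi_norm (x i - x j) _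

lemma sq_sqrt_mul_le {U : ℝ → ℝ} {V : (Fin d → ℝ) → ℝ} {x : Config n d} {a : ℝ}
    (h : a ≠ 0 → interaction U x = 0) :
    (Real.sqrt (interaction U x + external V x) * a) ^ 2 ≤ ∑ j, |V (x j)| * a ^ 2 := by
  by_cases ha : a = 0
  · simp [ha]
  rw [h ha, zero_add, mul_pow, ← Finset.sum_mul]
  gcongr
  have h1 : Real.sqrt (external V x) ^ 2 ≤ |external V x| := by
    rcases le_total 0 (external V x) with h | h
    · rw [Real.sq_sqrt h]
      exact le_abs_self _
    · rw [Real.sqrt_eq_zero_of_nonpos h]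
      simp
  exact h1.trans (Finset.abs_sum_le_sum_abs _ _)

theorem exists_small_energy (hd : 1 ≤ d) {U : ℝ → ℝ} {V : (Fin d → ℝ) → ℝ}
    (hU : ∃ r₀ : ℝ, 0 < r₀ ∧ ∀ x y : Fin d → ℝ, r₀ < ‖x - y‖ → U ‖x - y‖ = 0)
    (hV : MemLp V 2 volume) {ε : ℝ} (hε : 0 < ε) :
    ∃ φ : Config n d → ℝ, ContDiff ℝ (⊤ : ℕ∞) φ ∧ HasCompactSupport φ ∧ 0 < ∫ x, φ x ^ 2 ∧
      (∑ p, ∫ x, (fderiv ℝ φ x (unitVec p)) ^ 2)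
        + ∫ x, (Real.sqrt (interaction U x + external V x) * φ x) ^ 2
        ≤ ε * ∫ x, φ x ^ 2 := by
  obtain ⟨r₀, -, hr₀⟩ := hU
  let φ : ContDiffBump (spreadCenter n d) := ⟨1 / 2, 1, by norm_num, by norm_num⟩
  have hφ : ContDiff ℝ (⊤ : ℕ∞) φ := φ.contDiff
  have hcs : HasCompactSupport φ := φ.hasCompactSupport
  have hsupp : ∀ x, φ x ≠ 0 → x ∈ Metric.ball (spreadCenter n d) 1 := fun x hx => by
    rw [← φ.support_eq]
    exact hx
  have hφ1 : ∀ x, |φ x| ≤ 1 := fun x => by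
    rw [abs_of_nonneg φ.nonneg]
    exact φ.le_one
  set M := ∫ x, φ x ^ 2 with hM
  have hMpos : 0 < M := by
    refine ((φ.continuous.pow 2).integral_pos_of_hasCompactSupport_nonneg_nonzero
      (x := spreadCenter n d) (hcs.comp_left (g := fun t : ℝ => t ^ 2) (by simp))
      (fun x => sq_nonneg _) ?_)
    have : φ (spreadCenter n d) = 1 :=
      φ.one_of_mem_closedBall (Metric.mem_closedBall_self (by norm_num))
    simp [this]
  choose K hK using integral_abs_comp_eval_mul_sq_le hd hV hφ1 hsupp
  set G := ∑ p, ∫ x, (fderiv ℝ φ x (unitVec p)) ^ 2 with hG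
  have hG0 : 0 ≤ G := Finset.sum_nonneg fun p _ => integral_nonneg fun x => sq_nonneg _
  -- t > 1 compares powers of t, t > r₀ switches off the interaction, and the last bound gives t⁻¹(G
  -- + ∑ K) ≤ εM.
  obtain ⟨t, ht⟩ := exists_gt (max (max 1 r₀) ((G + ∑ j, K j) / (ε * M)))
  rw [max_lt_iff, max_lt_iff, div_lt_iff₀ (by positivity)] at ht
  obtain ⟨⟨ht1, htr⟩, htK⟩ := ht
  have ht0 : 0 < t := by linarith
  set s := t ^ 2 with hs
  have hst : t ≤ s := le_self_pow₀ ht1.le two_ne_zero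
  have hs0 : 0 < s := by positivity
  set S := s ^ Module.finrank ℝ (Config n d) with hS
  have hS0 : 0 < S := by positivity
  have hscale : ∀ f : Config n d → ℝ, ∫ x, f (s⁻¹ • x) = S * ∫ x, f x := fun f => by
    rw [Measure.integral_comp_inv_smul, abs_of_nonneg hS0.le, smul_eq_mul]
  have hψ : ContDiff ℝ (⊤ : ℕ∞) fun x => φ (s⁻¹ • x) := hφ.comp (contDiff_const_smul _)
  have hψc : HasCompactSupport fun x => φ (s⁻¹ • x) := hcs.comp_smul (by positivity)
  have hmass : ∫ x, φ (s⁻¹ • x) ^ 2 = S * M := hscale fun x => φ x ^ 2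
  refine ⟨fun x => φ (s⁻¹ • x), hψ, hψc, by rw [hmass]; positivity, ?_⟩
  have hgrad : ∑ p, ∫ x, (fderiv ℝ (fun x => φ (s⁻¹ • x)) x (unitVec p)) ^ 2
      ≤ S * (t⁻¹ * G) := by
    simp only [fderiv_comp_const_smul_apply (hφ.differentiable (by simp)), mul_pow,
      integral_const_mul]
    rw [Finset.sum_congr rfl fun p _ =>
      congrArg _ (hscale fun x => (fderiv ℝ φ x (unitVec p)) ^ 2), ← Finset.mul_sum,
      ← Finset.mul_sum, ← hG, mul_left_comm]
    -- The kinetic factor s⁻² = t⁻⁴ is weakened to t⁻¹ to match the potential term.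
    gcongr
    rw [inv_pow]
    exact inv_anti₀ ht0 (hst.trans (le_self_pow₀ (ht1.le.trans hst) two_ne_zero))
  have hVint := fun j => integrable_abs_comp_eval_mul_sq hV hψ.continuous hψc j
  have hpot : ∫ x, (Real.sqrt (interaction U x + external V x) * φ (s⁻¹ • x)) ^ 2
      ≤ S * (t⁻¹ * ∑ j, K j) := by
    calc ∫ x, (Real.sqrt (interaction U x + external V x) * φ (s⁻¹ • x)) ^ 2
        ≤ ∫ x : Config n d, ∑ j, |V (x j)| * φ (s⁻¹ • x) ^ 2 := by
          refine integral_mono_of_nonneg (ae_of_all _ fun x => sq_nonneg _)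
            (integrable_finsetSum _ fun j _ => hVint j) (ae_of_all _ fun x => ?_)
          exact sq_sqrt_mul_le fun hx =>
            interaction_eq_zero_of_mem_ball hd hr₀ (htr.trans_le hst) hs0 (hsupp _ hx)
      _ = ∑ j, ∫ x : Config n d, |V (x j)| * φ (s⁻¹ • x) ^ 2 :=
          integral_finsetSum _ fun j _ => hVint j
      _ ≤ ∑ j, S * (t⁻¹ * K j) := Finset.sum_le_sum fun j _ => hK j t ht1.le
      _ = S * (t⁻¹ * ∑ j, K j) := by rw [Finset.mul_sum, Finset.mul_sum]
  rw [hmass]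
  refine (add_le_add hgrad hpot).trans ?_
  rw [← mul_add, ← mul_add, mul_left_comm ε]
  refine mul_le_mul_of_nonneg_left ?_ hS0.le
  rw [inv_mul_le_iff₀ ht0]
  linarith

end Energy

theorem spec_hamiltonian {d : ℕ} (hd : 1 ≤ d) (n : ℕ) {U : ℝ → ℝ} (hU_L2 : MemLp U 2 volume)
    (hU : ∃ r₀ : ℝ, 0 < r₀ ∧ ∀ x y : Fin d → ℝ, r₀ < ‖x - y‖ → U ‖x - y‖ = 0)
    {V : (Fin d → ℝ) → ℝ} (hV : MemLp V 2 volume) :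
    (0 : ℂ) ∈ spec (hamiltonian n U V) ∧
      spec (hamiltonian n U V) ⊆ {z : ℂ | z.im = 0 ∧ 0 ≤ z.re} := by
  have hW : LocallyIntegrable (fun x : Config n d => interaction U x + external V x) volume :=
    (locallyIntegrable_interaction hd (hU_L2.locallyIntegrable one_le_two)).add
      (locallyIntegrable_external (hV.locallyIntegrable one_le_two))
  exact ⟨zero_mem_spec_schrodinger hW fun ε hε => exists_small_energy hd hU hV hε,
    spec_schrodinger_subset hW⟩

end Anderson

end

theorem theorem1
    -- the dimension, the number of particles and the probability space
    (d N : ℕ) (hd : 1 ≤ d) (hN : 2 ≤ N)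
    {Ω : Type*} [MeasurableSpace Ω] (P : Measure Ω) [IsProbabilityMeasure P]
    -- (I): the interaction is square integrable, non-negative and of finite range
    (U : ℝ → ℝ) (hU_L2 : MemLp U 2 volume) (hU_nonneg : ∀ r, 0 ≤ U r)
    (hU_range : ∃ r₀ : ℝ, 0 < r₀ ∧ ∀ x y : Fin d → ℝ, r₀ < ‖x - y‖ → U ‖x - y‖ = 0)
    -- (P): the external potential is i.i.d., square integrable and non-negative
    (V : (Fin d → ℝ) → Ω → ℝ)
    (hV_indep : iIndepFun V P) (hV_ident : ∀ x y, IdentDistrib (V x) (V y) P P)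
    (hV_L2 : ∀ᵐ ω ∂P, MemLp (fun x => V x ω) 2 volume)
    (hV_nonneg : ∀ᵐ ω ∂P, ∀ᵐ x, 0 ≤ V x ω)
    -- (R): the interaction is bounded relative to the non-interacting Hamiltonian
    (hR : ∀ᵐ ω ∂P, MulResolventBounded (interaction U) (freeHamiltonian N fun x => V x ω)) :
    (∀ᵐ ω ∂P, (0 : ℂ) ∈ spec (hamiltonian N U fun x => V x ω) ∧
        spec (hamiltonian N U fun x => V x ω) ⊆ {z : ℂ | z.im = 0 ∧ 0 ≤ z.re}) ∧
      ∀ n : ℕ, 1 ≤ n → n ≤ N →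
        ∀ᵐ ω ∂P, specBottom (hamiltonian n U fun x => V x ω) = 0 := by
  have hspec : ∀ n : ℕ, ∀ᵐ ω ∂P, (0 : ℂ) ∈ spec (hamiltonian n U fun x => V x ω) ∧
      spec (hamiltonian n U fun x => V x ω) ⊆ {z : ℂ | z.im = 0 ∧ 0 ≤ z.re} := fun n => by
    filter_upwards [hV_L2] with ω hω
    exact spec_hamiltonian hd n hU_L2 hU_range hω
  refine ⟨hspec N, fun n _ _ => ?_⟩
  filter_upwards [hspec n] with ω hω
  exact specBottom_eq_zero hω.1 hω.2
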